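/- Let $G=(V,E)$ be a connected finite simple graph with symmetric edge weights $w_{xy}=w_{yx}>0$ ($xy\in E$) and a vertex measure $\mu:V\to(0,\infty)$. Write $|V|=\sum_{x\in V}\mu(x)$, let $$\Delta u(x)=\frac1{\mu(x)}\sum_{y\sim x}w_{yx}\,(u(y)-u(x)),$$ and let $\delta_p$ be the Dirac mass at $p\in V$, i.e. $\delta_p(p)=1/\mu(p)$ and $\delta_p(x)=0$ for $x\ne p$. Let $n\ge 1$ and let $K$ be a real $n\times n$ matrix such that $K^T=PS$, where $P=\mathrm{diag}(P_1,\dots,P_n)$ with all $P_i>0$, and $S$ is a symmetric positive definite matrix whose off-diagonal entries are $\le 0$ and for which all entries of $S^{-1}$ are positive. Let $N_1,\dots,N_n\ge 0$ be integers, let $p_{ij}\in V$ ($1\le i\le n$, $1\le j\le N_i$) be vertices (repetitions are allowed), and consider, for $\lambda>0$ and $u_1,\dots,u_n:V\to\mathbb R$, the system $$\Delta u_i=\lambda\Big(\sum_{j=1}^n\sum_{k=1}^n K_{kj}K_{ji}e^{u_j}e^{u_k}-\sum_{j=1}^n K_{ji}e^{u_j}\Big)+4\pi\sum_{j=1}^{N_i}\delta_{p_{ij}}\quad\text{on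 }V,\qquad i=1,\dots,n. \tag{1}$$ Put $$\lambda_0=\frac{16\pi}{|V|}\,\frac{\sum_{i=1}^n\sum_{j=1}^n P_i^{-1}(K^{-1})_{ji}N_j}{\sum_{i=1}^n\sum_{j=1}^n P_i^{-1}(K^{-1})_{ji}}.$$ (i) If $\lambda>0$ and (1) has a solution, then $\lambda\ge\lambda_0$. Moreover $\lambda>\lambda_0$, unless there is a constant $c>0$ such that $\#\{j: p_{ij}=x\}=c\,\mu(x)$ for all $i\in\{1,\dots,n\}$ and all $x\in V$. (If the $p_{ij}$ are pairwise distinct, this exceptional case occurs only when $n=1$, every vertex is a vortex point, and $\mu$ is constant.) (ii) There is a constant $\lambda_1>\lambda_0$ such that (1) has a solution for every $\lambda>\lambda_1$. -/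

import Mathlib

/-- A weighted graph on the vertex set `V`: a simple graph with a symmetric positive weight `w` on
its edges and a positive measure `μ` on its vertices. -/
structure WeightedGraph (V : Type*) where
  graph : SimpleGraph V
  w : V → V → ℝ
  w_pos : ∀ x y, graph.Adj x y → 0 < w x y
  w_symm : ∀ x y, graph.Adj x y → w x y = w y x
  μ : V → ℝ
  μ_pos : ∀ x, 0 < μ x

open scoped Classical in
/-- The graph Laplacian `Δu(x) = (1 / μ(x)) ∑_{y ∼ x} w_{yx} (u(y) - u(x))`. -/
noncomputable def WeightedGraph.laplacian {V : Type*} [Fintype V] (G : WeightedGraph V)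
    (u : V → ℝ) (x : V) : ℝ :=
  (1 / G.μ x) * ∑ y ∈ Finset.univ.filter (fun y => G.graph.Adj x y), G.w y x * (u y - u x)

/-- The volume `|V| = ∑_x μ(x)`. -/
noncomputable def WeightedGraph.vol {V : Type*} [Fintype V] (G : WeightedGraph V) : ℝ :=
  ∑ x, G.μ x

open scoped Classical in
/-- The Dirac mass at the vertex `p` as a density with respect to `μ`, so that
`∑_x μ(x) f(x) δ_p(x) = f(p)` for every function `f`. -/
noncomputable def WeightedGraph.dirac {V : Type*} (G : WeightedGraph V) (p x : V) : ℝ :=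
  if x = p then 1 / G.μ p else 0

/-- `u = (u_1, …, u_n)` solves the relativistic non-Abelian Chern–Simons–Higgs system on `G` with
matrix `K`, coupling parameter `lam` and vortex points `p i j`, `j = 1, …, N i`. -/
def IsCSHSolution {V : Type*} [Fintype V] (G : WeightedGraph V) {n : ℕ}
    (K : Matrix (Fin n) (Fin n) ℝ) (N : Fin n → ℕ) (p : (i : Fin n) → Fin (N i) → V) (lam : ℝ)
    (u : Fin n → V → ℝ) : Prop :=
  ∀ i x, G.laplacian (u i) x =
    lam * ((∑ j, ∑ k, K k j * K j i * Real.exp (u j x) * Real.exp (u k x))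
        - ∑ j, K j i * Real.exp (u j x))
      + 4 * Real.pi * ∑ j, G.dirac (p i j) x

/-- The threshold
`λ₀ = (16π / |V|) (∑ᵢⱼ Pᵢ⁻¹ (K⁻¹)ⱼᵢ Nⱼ) / (∑ᵢⱼ Pᵢ⁻¹ (K⁻¹)ⱼᵢ)`. -/
noncomputable def cshThreshold {V : Type*} [Fintype V] (G : WeightedGraph V) {n : ℕ}
    (K : Matrix (Fin n) (Fin n) ℝ) (P : Fin n → ℝ) (N : Fin n → ℕ) : ℝ :=
  (16 * Real.pi / G.vol) *
    ((∑ i, ∑ j, (P i)⁻¹ * K⁻¹ j i * (N j : ℝ)) / ∑ i, ∑ j, (P i)⁻¹ * K⁻¹ j i)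

/-- The degenerate vortex configuration: the number of vortex points of index `i` at the vertex `x`,
divided by `μ(x)`, is one and the same positive number for all `i` and all `x`. -/
def IsUniformVortexConfig {V : Type*} (G : WeightedGraph V) {n : ℕ} (N : Fin n → ℕ)
    (p : (i : Fin n) → Fin (N i) → V) : Prop :=
  ∃ c : ℝ, 0 < c ∧ ∀ i x, (Nat.card {j : Fin (N i) // p i j = x} : ℝ) = c * G.μ x

open Matrix Filter Topology

/-! ### Integration on a weighted graph -/

namespace WeightedGraph

variable {V : Type*} (G : WeightedGraph V)

/-! Let `a = S⁻¹(P⁻¹1) > 0`, so that `u_j = log a_j` is a constant zero of the nonlinearity.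
Necessity: integrating each equation over `V` kills the Laplacian. Summing with weights `a_i / P_i`
turns the nonlinearity into the `S`-form at `e^u - a/2` minus a constant
(`sum_vacuum_mul_cshForce`). Nonnegativity of the form gives `λ ≥ λ₀`; equality forces `e^u = a/2`
everywhere, and the equations then make the vortex density constant. Existence: after division by `λ
= ε⁻¹`, the constant `log a` solves the system at `ε = 0`. The derivative there is surjective, so
solutions persist for small `ε`. -/

theorem measure_mul_sum_dirac {m : ℕ} (p : Fin m → V) (x : V) :
    G.μ x * ∑ j, G.dirac (p j) x = Nat.card {j : Fin m // p j = x} := by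
  classical
  rw [Nat.card_eq_fintype_card, Fintype.card_subtype, Finset.card_filter, Finset.mul_sum]
  push_cast
  refine Finset.sum_congr rfl fun j _ => ?_
  by_cases h : p j = x
  · subst h; simp [dirac, (G.μ_pos _).ne']
  · simp [dirac, h, Ne.symm h]

variable [Fintype V]

theorem sum_measure_mul_laplacian (u : V → ℝ) : ∑ x, G.μ x * G.laplacian u x = 0 := by
  classical
  set f : V → V → ℝ := fun x y => if G.graph.Adj x y then G.w y x * (u y - u x) else 0 with hf
  have h1 : ∀ x, G.μ x * G.laplacian u x = ∑ y, f x y := fun x => by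
    have := (G.μ_pos x).ne'
    rw [laplacian, Finset.sum_filter, ← mul_assoc, mul_one_div_cancel this, one_mul]
  -- The edge flux is antisymmetric, so its double sum vanishes.
  have h2 : ∀ x y, f x y = -f y x := fun x y => by
    by_cases h : G.graph.Adj x y
    · simp only [hf, if_pos h, if_pos h.symm, G.w_symm x y h]; ring
    · simp only [hf, if_neg h, if_neg fun h' => h (SimpleGraph.Adj.symm h'), neg_zero]
  have h3 : ∑ x, ∑ y, f x y = -∑ x, ∑ y, f x y := by
    conv_lhs => rw [Finset.sum_comm]
    simp_rw [← Finset.sum_neg_distrib]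
    exact Finset.sum_congr rfl fun y _ => Finset.sum_congr rfl fun x _ => h2 x y
  rw [Finset.sum_congr rfl fun x _ => h1 x]
  linarith

theorem laplacian_const (c : ℝ) (x : V) : G.laplacian (fun _ => c) x = 0 := by
  simp [laplacian]

theorem vol_pos [Nonempty V] : 0 < G.vol :=
  Finset.sum_pos (fun x _ => G.μ_pos x) Finset.univ_nonempty

theorem sum_measure_mul_dirac (p : V) : ∑ x, G.μ x * G.dirac p x = 1 := by
  classical
  rw [Finset.sum_eq_single p]
  · simp [dirac, (G.μ_pos p).ne']
  · intro x _ hx; simp [dirac, hx]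
  · simp

end WeightedGraph

/-! ### The vacuum and the quadratic form of `S` -/

/-- The vacuum `a = S⁻¹ (P⁻¹ 1)` is entrywise positive and satisfies `Kᵀ a = 1`. -/
theorem exists_vacuum {n : ℕ} (hn : 1 ≤ n) {S : Matrix (Fin n) (Fin n) ℝ} {P : Fin n → ℝ}
    (hP : ∀ i, 0 < P i) (hS : S.PosDef) (hSinv : ∀ i j, 0 < S⁻¹ i j) :
    ∃ a : Fin n → ℝ, (∀ i, 0 < a i) ∧ ∀ j, ∑ k, S k j * a k = (P j)⁻¹ := by
  have : Nonempty (Fin n) := ⟨⟨0, hn⟩⟩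
  have hu : IsUnit S.det := isUnit_iff_ne_zero.2 hS.det_pos.ne'
  refine ⟨S⁻¹ *ᵥ fun i => (P i)⁻¹, fun i => ?_, fun j => ?_⟩
  · exact Finset.sum_pos (fun j _ => mul_pos (hSinv i j) (inv_pos.2 (hP j)))
      Finset.univ_nonempty
  · have h : (S *ᵥ (S⁻¹ *ᵥ fun i => (P i)⁻¹)) j = (P j)⁻¹ := by
      rw [mulVec_mulVec, mul_nonsing_inv _ hu, one_mulVec]
    rw [← h]
    refine Finset.sum_congr rfl fun k _ => ?_
    rw [← hS.isHermitian.apply k j]; simp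

theorem Matrix.PosDef.sum_nonneg {n : ℕ} {S : Matrix (Fin n) (Fin n) ℝ} (hS : S.PosDef)
    (b : Fin n → ℝ) : 0 ≤ ∑ j, ∑ k, S k j * b j * b k := by
  have h := hS.posSemidef.dotProduct_mulVec_nonneg b
  rw [Finset.sum_comm]
  simpa [dotProduct, mulVec, Finset.mul_sum, mul_comm, mul_left_comm, mul_assoc] using h

theorem Matrix.PosDef.eq_zero_of_sum_eq_zero {n : ℕ} {S : Matrix (Fin n) (Fin n) ℝ}
    (hS : S.PosDef) {b : Fin n → ℝ} (hb : ∑ j, ∑ k, S k j * b j * b k = 0) : b = 0 := by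
  by_contra hne
  have h := hS.dotProduct_mulVec_pos hne
  rw [Finset.sum_comm] at hb
  refine h.ne' ?_
  rw [← hb]
  simp [dotProduct, mulVec, Finset.mul_sum, mul_comm, mul_left_comm]

/-- Completing the square at half the vacuum. -/
theorem sum_sq_sub_half_vacuum {n : ℕ} {S : Matrix (Fin n) (Fin n) ℝ} {q a : Fin n → ℝ}
    (hS : ∀ i j, S i j = S j i) (ha : ∀ j, ∑ k, S k j * a k = q j) (b : Fin n → ℝ) :
    ∑ j, ∑ k, S k j * (b j - a j / 2) * (b k - a k / 2) =
      ∑ j, ∑ k, S k j * b j * b k - ∑ j, q j * b j + (∑ j, q j * a j) / 4 := by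
  have h1 : ∀ c : Fin n → ℝ, ∑ j, ∑ k, S k j * c j * a k = ∑ j, q j * c j := fun c =>
    Finset.sum_congr rfl fun j _ => by
      rw [← ha j, Finset.sum_mul]
      exact Finset.sum_congr rfl fun k _ => by ring
  have h2 : ∑ j, ∑ k, S k j * a j * b k = ∑ j, q j * b j := by
    rw [← h1 b, Finset.sum_comm]
    exact Finset.sum_congr rfl fun j _ => Finset.sum_congr rfl fun k _ => by
      rw [hS j k]; ring
  have h3 : ∑ j, ∑ k, S k j * (b j - a j / 2) * (b k - a k / 2) =
      ∑ j, ∑ k, S k j * b j * b k - (∑ j, ∑ k, S k j * b j * a k) / 2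
        - (∑ j, ∑ k, S k j * a j * b k) / 2 + (∑ j, ∑ k, S k j * a j * a k) / 4 := by
    simp only [Finset.sum_div, ← Finset.sum_sub_distrib, ← Finset.sum_add_distrib]
    exact Finset.sum_congr rfl fun j _ => Finset.sum_congr rfl fun k _ => by ring
  rw [h3, h1, h1, h2]; ring

/-! ### The nonlinearity and the necessary condition -/

/-- The nonlinearity of the system, in the variables `u`. -/
noncomputable def cshForce {n : ℕ} (K : Matrix (Fin n) (Fin n) ℝ) (v : Fin n → ℝ) (i : Fin n) : ℝ :=
  (∑ j, ∑ k, K k j * K j i * Real.exp (v j) * Real.exp (v k)) - ∑ j, K j i * Real.exp (v j)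

/-- In this factored form the inner bracket vanishes at the vacuum. -/
theorem cshForce_eq {n : ℕ} (K : Matrix (Fin n) (Fin n) ℝ) (v : Fin n → ℝ) (i : Fin n) :
    cshForce K v i = ∑ j, K j i * (Real.exp (v j) * (∑ k, K k j * Real.exp (v k) - 1)) := by
  rw [cshForce, ← Finset.sum_sub_distrib]
  refine Finset.sum_congr rfl fun j _ => ?_
  rw [mul_sub, mul_sub, mul_one, Finset.mul_sum, Finset.mul_sum]
  congr 1
  exact Finset.sum_congr rfl fun k _ => by ring

section Data

variable {n : ℕ} {K S : Matrix (Fin n) (Fin n) ℝ} {P a : Fin n → ℝ}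

theorem apply_eq_of_transpose_eq (hK : Kᵀ = diagonal P * S) (i j : Fin n) :
    K i j = P j * S j i := by
  rw [← transpose_apply K, hK, diagonal_mul]

/-- The weights `a_i / P_i` collapse the outer factor `K j i` to `1 / P_j`, which cancels the `P_j`
in `K k j = P_j S_{jk}`. What remains is the form of `S` minus a linear term, and the square is
completed. -/
theorem sum_vacuum_mul_cshForce (hP : ∀ i, 0 < P i) (hK : Kᵀ = diagonal P * S)
    (hS : ∀ i j, S i j = S j i) (ha : ∀ j, ∑ k, S k j * a k = (P j)⁻¹) (v : Fin n → ℝ) :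
    ∑ i, (P i)⁻¹ * a i * cshForce K v i =
      ∑ j, ∑ k, S k j * (Real.exp (v j) - a j / 2) * (Real.exp (v k) - a k / 2)
        - (∑ j, (P j)⁻¹ * a j) / 4 := by
  have h1 : ∀ j, ∑ i, (P i)⁻¹ * a i * K j i = (P j)⁻¹ := fun j => by
    rw [← ha j]
    refine Finset.sum_congr rfl fun i _ => ?_
    rw [apply_eq_of_transpose_eq hK]
    have := (hP i).ne'
    field_simp
  rw [sum_sq_sub_half_vacuum hS ha]
  simp_rw [cshForce_eq, Finset.mul_sum]
  rw [Finset.sum_comm, add_sub_cancel_right, ← Finset.sum_sub_distrib]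
  refine Finset.sum_congr rfl fun j _ => ?_
  simp_rw [← mul_assoc, ← Finset.sum_mul, h1]
  rw [mul_sub, mul_one, Finset.mul_sum]
  congr 1
  refine Finset.sum_congr rfl fun k _ => ?_
  rw [apply_eq_of_transpose_eq hK, hS j k]
  have := (hP j).ne'
  field_simp

/-- The weights of the threshold are `∑ᵢ Pᵢ⁻¹ (K⁻¹)ⱼᵢ = Pⱼ⁻¹ aⱼ`, with `a` the vacuum. -/
theorem sum_inv_mul_eq_vacuum (hP : ∀ i, 0 < P i) (hK : Kᵀ = diagonal P * S) (hS : S.PosDef)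
    (ha : ∀ j, ∑ k, S k j * a k = (P j)⁻¹) (j : Fin n) :
    ∑ i, (P i)⁻¹ * K⁻¹ j i = (P j)⁻¹ * a j := by
  have hdet : IsUnit K.det := by
    rw [← det_transpose, hK, det_mul, det_diagonal]
    exact isUnit_iff_ne_zero.2
      (mul_pos (Finset.prod_pos fun i _ => hP i) hS.det_pos).ne'
  have h : K *ᵥ (fun j => (P j)⁻¹ * a j) = fun i => (P i)⁻¹ := by
    funext j
    rw [← ha j, mulVec, dotProduct]
    refine Finset.sum_congr rfl fun i _ => ?_
    rw [apply_eq_of_transpose_eq hK]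
    have := (hP i).ne'
    field_simp
  have h' := congrFun (congrArg (K⁻¹ *ᵥ ·) h) j
  simp only [mulVec_mulVec, nonsing_inv_mul _ hdet, one_mulVec] at h'
  rw [h']
  simp [mulVec, dotProduct, mul_comm]

theorem cshThreshold_eq {V : Type*} [Fintype V] (G : WeightedGraph V) (hP : ∀ i, 0 < P i)
    (hK : Kᵀ = diagonal P * S) (hS : S.PosDef) (ha : ∀ j, ∑ k, S k j * a k = (P j)⁻¹)
    (N : Fin n → ℕ) :
    cshThreshold G K P N =
      (16 * Real.pi / G.vol) * ((∑ j, (P j)⁻¹ * a j * N j) / ∑ j, (P j)⁻¹ * a j) := by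
  have h := sum_inv_mul_eq_vacuum hP hK hS ha
  have h1 : ∑ i, ∑ j, (P i)⁻¹ * K⁻¹ j i * (N j : ℝ) = ∑ j, (P j)⁻¹ * a j * N j := by
    rw [Finset.sum_comm]
    simp_rw [← Finset.sum_mul, h]
  have h2 : ∑ i, ∑ j, (P i)⁻¹ * K⁻¹ j i = ∑ j, (P j)⁻¹ * a j := by
    rw [Finset.sum_comm]
    simp_rw [h]
  rw [cshThreshold, h1, h2]

/-- The integrated identity behind the necessary condition. -/
theorem IsCSHSolution.integral_identity {V : Type*} [Fintype V] {G : WeightedGraph V}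
    {N : Fin n → ℕ} {p : (i : Fin n) → Fin (N i) → V} {lam : ℝ} {u : Fin n → V → ℝ}
    (hu : IsCSHSolution G K N p lam u) (hP : ∀ i, 0 < P i) (hK : Kᵀ = diagonal P * S)
    (hS : ∀ i j, S i j = S j i) (ha : ∀ j, ∑ k, S k j * a k = (P j)⁻¹) :
    lam * (∑ x, G.μ x * ∑ j, ∑ k, S k j * (Real.exp (u j x) - a j / 2) *
        (Real.exp (u k x) - a k / 2)) + 4 * Real.pi * ∑ i, (P i)⁻¹ * a i * N i =
      lam * ((∑ j, (P j)⁻¹ * a j) / 4) * G.vol := by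
  have hi : ∀ i, lam * ∑ x, G.μ x * cshForce K (fun j => u j x) i + 4 * Real.pi * N i = 0 := by
    intro i
    have h0 := G.sum_measure_mul_laplacian (u i)
    have hN : ∑ x, G.μ x * ∑ j, G.dirac (p i j) x = N i := by
      simp_rw [Finset.mul_sum]
      rw [Finset.sum_comm]
      simp [G.sum_measure_mul_dirac]
    rw [← h0, ← hN, Finset.mul_sum, Finset.mul_sum, ← Finset.sum_add_distrib]
    refine Finset.sum_congr rfl fun x _ => ?_
    rw [hu i x, cshForce]; ring
  have hsum : ∑ i, (P i)⁻¹ * a i *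
      (lam * ∑ x, G.μ x * cshForce K (fun j => u j x) i + 4 * Real.pi * N i) = 0 :=
    Finset.sum_eq_zero fun i _ => by rw [hi, mul_zero]
  have hF : ∑ i, (P i)⁻¹ * a i * (lam * ∑ x, G.μ x * cshForce K (fun j => u j x) i) =
      lam * ∑ x, G.μ x * ∑ i, (P i)⁻¹ * a i * cshForce K (fun j => u j x) i := by
    simp_rw [Finset.mul_sum]
    rw [Finset.sum_comm]
    exact Finset.sum_congr rfl fun x _ => Finset.sum_congr rfl fun i _ => by ring
  have hC : ∑ i, (P i)⁻¹ * a i * (4 * Real.pi * N i) =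
      4 * Real.pi * ∑ i, (P i)⁻¹ * a i * N i := by
    rw [Finset.mul_sum]
    exact Finset.sum_congr rfl fun i _ => by ring
  simp_rw [mul_add, Finset.sum_add_distrib] at hsum
  rw [hF, hC] at hsum
  have hQ : ∀ (Q : V → ℝ) (D : ℝ), ∑ x, G.μ x * (Q x - D) = ∑ x, G.μ x * Q x - G.vol * D :=
    fun Q D => by
      rw [WeightedGraph.vol, Finset.sum_mul, ← Finset.sum_sub_distrib]
      exact Finset.sum_congr rfl fun x _ => mul_sub _ _ _
  simp_rw [sum_vacuum_mul_cshForce hP hK hS ha] at hsum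
  rw [hQ] at hsum
  linarith

/-- Where all `e^{u_j}` equal half the vacuum, the solution forces a uniform vortex
configuration. -/
theorem IsCSHSolution.isUniformVortexConfig {V : Type*} [Fintype V] {G : WeightedGraph V}
    {N : Fin n → ℕ} {p : (i : Fin n) → Fin (N i) → V} {lam : ℝ} {u : Fin n → V → ℝ}
    (hu : IsCSHSolution G K N p lam u) (hlam : 0 < lam) (hP : ∀ i, 0 < P i)
    (hK : Kᵀ = diagonal P * S) (hS : ∀ i j, S i j = S j i)
    (ha : ∀ j, ∑ k, S k j * a k = (P j)⁻¹) (h : ∀ j x, Real.exp (u j x) = a j / 2) :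
    IsUniformVortexConfig G N p := by
  have hvac : ∀ j, ∑ k, K k j * (a k / 2) = 1 / 2 := fun j => by
    have : ∑ k, K k j * (a k / 2) = P j / 2 * ∑ k, S k j * a k := by
      rw [Finset.mul_sum]
      refine Finset.sum_congr rfl fun k _ => ?_
      rw [apply_eq_of_transpose_eq hK, hS j k]; ring
    rw [this, ha j]
    have := (hP j).ne'
    field_simp
  -- At half the vacuum the nonlinearity equals `-1/4`, so each equation reads `0 = -λ/4 + 4π ·
  -- (vortex density)`.
  refine ⟨lam / (16 * Real.pi), by positivity, fun i x => ?_⟩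
  have hconst : u i = fun _ => Real.log (a i / 2) := by
    funext y
    rw [← h i y, Real.log_exp]
  have hforce : cshForce K (fun j => u j x) i = -1 / 4 := by
    simp_rw [cshForce_eq, h, hvac]
    have : ∑ j, K j i * (a j / 2 * (1 / 2 - 1)) = -1 / 2 * ∑ j, K j i * (a j / 2) := by
      rw [Finset.mul_sum]
      exact Finset.sum_congr rfl fun j _ => by ring
    rw [this, hvac]; norm_num
  have hx := hu i x
  rw [hconst, G.laplacian_const] at hx
  change 0 = lam * cshForce K (fun j => u j x) i + _ at hx
  rw [hforce] at hx
  rw [← G.measure_mul_sum_dirac]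
  have hpi := Real.pi_pos
  field_simp
  linear_combination (-4 * G.μ x) * hx

end Data

/-! ### Existence for large coupling -/

section Existence

variable {V : Type*} [Fintype V] {n : ℕ} {K : Matrix (Fin n) (Fin n) ℝ}

/-- The system divided by `lam = ε⁻¹`. -/
noncomputable def cshRescaled (G : WeightedGraph V) (K : Matrix (Fin n) (Fin n) ℝ)
    (m : Fin n → V → ℝ) (z : ℝ × (Fin n → V → ℝ)) : ℝ × (Fin n → V → ℝ) :=
  -- Keeping `ε` as the first output lets local surjectivity prescribe it.
  (z.1, fun i x => z.1 * (G.laplacian (z.2 i) x - m i x) - cshForce K (fun j => z.2 j x) i)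

theorem contDiff_cshRescaled (G : WeightedGraph V) (m : Fin n → V → ℝ) :
    ContDiff ℝ 1 (cshRescaled G K m) := by
  unfold cshRescaled cshForce WeightedGraph.laplacian
  fun_prop

/-- The bracket in `cshForce_eq` is zero at `v₀`, so only its own derivative survives in the product
rule. -/
theorem hasDerivAt_cshForce_vacuum {v₀ : Fin n → ℝ}
    (hv₀ : ∀ j, ∑ k, K k j * Real.exp (v₀ k) = 1) (v : Fin n → ℝ) (i : Fin n) :
    HasDerivAt (fun t : ℝ => cshForce K (fun j => v₀ j + t * v j) i)
      (∑ j, K j i * (Real.exp (v₀ j) * ∑ k, K k j * (Real.exp (v₀ k) * v k))) 0 := by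
  have he : ∀ j, HasDerivAt (fun t : ℝ => Real.exp (v₀ j + t * v j)) (Real.exp (v₀ j) * v j) 0 :=
    fun j => by
      have := (((hasDerivAt_id (0 : ℝ)).mul_const (v j)).const_add (v₀ j)).exp
      simpa using this
  simp_rw [cshForce_eq]
  refine HasDerivAt.fun_sum fun j _ => HasDerivAt.const_mul _ ?_
  have h := (he j).fun_mul ((HasDerivAt.fun_sum (u := Finset.univ)
    fun k _ => (he k).const_mul (K k j)).sub_const 1)
  simpa [hv₀] using h

/-- Near the vacuum the rescaled system is a submersion, so it can be solved for small `ε`. -/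
theorem eventually_exists_cshRescaled_eq (G : WeightedGraph V) (m : Fin n → V → ℝ)
    (hdet : IsUnit K.det) {v₀ : Fin n → ℝ} (hv₀ : ∀ j, ∑ k, K k j * Real.exp (v₀ k) = 1) :
    ∀ᶠ ε in 𝓝 (0 : ℝ), ∃ z, cshRescaled G K m z = (ε, 0) := by
  set z₀ : ℝ × (Fin n → V → ℝ) := (0, fun j _ => v₀ j) with hz₀
  have hstrict : HasStrictFDerivAt (cshRescaled G K m) (fderiv ℝ (cshRescaled G K m) z₀) z₀ :=
    (contDiff_cshRescaled G m).contDiffAt.hasStrictFDerivAt one_ne_zero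
  have hval : cshRescaled G K m z₀ = (0, 0) := by
    refine Prod.ext rfl ?_
    funext i x
    simp [cshRescaled, hz₀, cshForce_eq, hv₀]
  have hderiv : ∀ d : ℝ × (Fin n → V → ℝ), fderiv ℝ (cshRescaled G K m) z₀ d =
      (d.1, fun i x => d.1 * (G.laplacian (z₀.2 i) x - m i x) -
        ∑ j, K j i * (Real.exp (v₀ j) * ∑ k, K k j * (Real.exp (v₀ k) * d.2 k x))) := by
    intro d
    -- The derivative is identified by restricting the map to lines through `z₀`.
    have hline : HasDerivAt (fun t : ℝ => z₀ + t • d) d 0 := by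
      simpa using ((hasDerivAt_id (0 : ℝ)).smul_const d).const_add z₀
    have h1 : HasDerivAt (fun t : ℝ => cshRescaled G K m (z₀ + t • d))
        (fderiv ℝ (cshRescaled G K m) z₀ d) 0 := by
      have h0 : HasFDerivAt (cshRescaled G K m) (fderiv ℝ (cshRescaled G K m) z₀)
          (z₀ + (0 : ℝ) • d) := by
        simpa using hstrict.hasFDerivAt
      exact h0.comp_hasDerivAt (0 : ℝ) hline
    refine h1.unique (HasDerivAt.prodMk ?_ ?_)
    · simpa [hz₀] using (hasDerivAt_id (0 : ℝ)).mul_const d.1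
    · refine hasDerivAt_pi.2 fun i => hasDerivAt_pi.2 fun x => ?_
      refine HasDerivAt.sub ?_ (hasDerivAt_cshForce_vacuum hv₀ (fun j => d.2 j x) i)
      have hd : DifferentiableAt ℝ (fun t : ℝ => G.laplacian ((z₀ + t • d).2 i) x - m i x) 0 := by
        unfold WeightedGraph.laplacian
        simp only [Prod.snd_add, Prod.smul_snd, Pi.add_apply, Pi.smul_apply]
        fun_prop
      have h2 : HasDerivAt (fun t : ℝ => (z₀ + t • d).1) d.1 0 := by
        simpa [hz₀] using (hasDerivAt_id (0 : ℝ)).mul_const d.1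
      have h3 := h2.fun_mul hd.hasDerivAt
      simpa [hz₀] using h3
  have hdetT : IsUnit Kᵀ.det := by rwa [det_transpose]
  have hinv : ∀ (b : Fin n → ℝ) (i : Fin n), ∑ j, K j i * (Kᵀ⁻¹ *ᵥ b) j = b i := fun b i => by
    have h : (Kᵀ *ᵥ (Kᵀ⁻¹ *ᵥ b)) i = b i := by
      rw [mulVec_mulVec, mul_nonsing_inv _ hdetT, one_mulVec]
    exact h
  have hcancel : ∀ j (r : ℝ), Real.exp (v₀ j) * (Real.exp (-v₀ j) * r) = r := fun j r => by
    rw [← mul_assoc, ← Real.exp_add, add_neg_cancel, Real.exp_zero, one_mul]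
  have hsurj : (fderiv ℝ (cshRescaled G K m) z₀).range = ⊤ := by
    refine LinearMap.range_eq_top.2 fun y => ?_
    -- With `E = diag(e^{v₀})`, the equation left for `d.2` at each vertex is `Kᵀ E Kᵀ E d = r`; the
    -- preimage inverts the four factors in turn.
    let r : V → Fin n → ℝ := fun x i => y.1 * (G.laplacian (z₀.2 i) x - m i x) - y.2 i x
    refine ⟨(y.1, fun k x => Real.exp (-v₀ k) * (Kᵀ⁻¹ *ᵥ fun j =>
      Real.exp (-v₀ j) * (Kᵀ⁻¹ *ᵥ r x) j) k), ?_⟩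
    refine (hderiv _).trans (Prod.ext rfl ?_)
    funext i x
    simp only [hcancel, hinv]
    simp [r]
  have hmap := hstrict.map_nhds_eq_of_surj hsurj
  rw [hval] at hmap
  have hev : ∀ᶠ y in 𝓝 ((0 : ℝ), (0 : Fin n → V → ℝ)), ∃ z, cshRescaled G K m z = y := by
    rw [← hmap, eventually_map]
    exact Eventually.of_forall fun z => ⟨z, rfl⟩
  exact (Continuous.tendsto' (f := fun ε : ℝ => (ε, (0 : Fin n → V → ℝ))) (by fun_prop) 0 _
    rfl).eventually hev

theorem eventually_exists_isCSHSolution (G : WeightedGraph V) (N : Fin n → ℕ)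
    (p : (i : Fin n) → Fin (N i) → V) (hdet : IsUnit K.det) {v₀ : Fin n → ℝ}
    (hv₀ : ∀ j, ∑ k, K k j * Real.exp (v₀ k) = 1) :
    ∀ᶠ lam in atTop, ∃ u, IsCSHSolution G K N p lam u := by
  have h := eventually_exists_cshRescaled_eq G
    (fun i x => 4 * Real.pi * ∑ j, G.dirac (p i j) x) hdet hv₀
  filter_upwards [tendsto_inv_atTop_zero.eventually h, eventually_gt_atTop 0] with lam hl hpos
  obtain ⟨z, hz⟩ := hl
  have h1 : z.1 = lam⁻¹ := congrArg Prod.fst hz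
  refine ⟨z.2, fun i x => ?_⟩
  have h2 : z.1 * (G.laplacian (z.2 i) x - 4 * Real.pi * ∑ j, G.dirac (p i j) x) -
      cshForce K (fun j => z.2 j x) i = 0 := congrFun (congrFun (congrArg Prod.snd hz) i) x
  change _ = lam * cshForce K (fun j => z.2 j x) i + _
  rw [h1] at h2
  field_simp at h2
  linarith

end Existence

theorem theorem1p1 {V : Type*} [Fintype V] (G : WeightedGraph V) (hG : G.graph.Connected)
    {n : ℕ} (hn : 1 ≤ n) (K S : Matrix (Fin n) (Fin n) ℝ) (P : Fin n → ℝ)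
    (hP : ∀ i, 0 < P i) (hK : K.transpose = Matrix.diagonal P * S) (hS : S.PosDef)
    (hSoff : ∀ i j, i ≠ j → S i j ≤ 0) (hSinv : ∀ i j, 0 < S⁻¹ i j)
    (N : Fin n → ℕ) (p : (i : Fin n) → Fin (N i) → V) :
    (∀ lam : ℝ, 0 < lam → (∃ u : Fin n → V → ℝ, IsCSHSolution G K N p lam u) →
      cshThreshold G K P N ≤ lam ∧
        (¬ IsUniformVortexConfig G N p → cshThreshold G K P N < lam)) ∧
    (∃ lam1 : ℝ, cshThreshold G K P N < lam1 ∧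
      ∀ lam : ℝ, lam1 < lam → ∃ u : Fin n → V → ℝ, IsCSHSolution G K N p lam u) := by
  have : Nonempty V := hG.nonempty
  have : Nonempty (Fin n) := ⟨⟨0, hn⟩⟩
  obtain ⟨a, hapos, ha⟩ := exists_vacuum hn hP hS hSinv
  have hsymm : ∀ i j, S i j = S j i := fun i j => by
    rw [← hS.isHermitian.apply i j]; simp
  constructor
  · rintro lam hlam ⟨u, hu⟩
    have hint := hu.integral_identity hP hK hsymm ha
    rw [cshThreshold_eq G hP hK hS ha]
    set Q : V → ℝ := fun x => ∑ j, ∑ k, S k j * (Real.exp (u j x) - a j / 2) *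
      (Real.exp (u k x) - a k / 2) with hQ
    have hQ0 : ∀ x, 0 ≤ Q x := fun x => hS.sum_nonneg fun j => Real.exp (u j x) - a j / 2
    have hμQ : ∀ x ∈ Finset.univ, 0 ≤ G.μ x * Q x := fun x _ =>
      mul_nonneg (G.μ_pos x).le (hQ0 x)
    have hD : 0 < ∑ j, (P j)⁻¹ * a j :=
      Finset.sum_pos (fun j _ => mul_pos (inv_pos.2 (hP j)) (hapos j)) Finset.univ_nonempty
    have hvol := G.vol_pos
    -- The excess over the threshold is a positive multiple of the integral of `Q`.
    have hlam_eq : lam - 16 * Real.pi / G.vol *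
        ((∑ j, (P j)⁻¹ * a j * N j) / ∑ j, (P j)⁻¹ * a j) =
          4 * lam * (∑ x, G.μ x * Q x) / (G.vol * ∑ j, (P j)⁻¹ * a j) := by
      generalize ∑ j, (P j)⁻¹ * a j = D at hD hint ⊢
      generalize ∑ j, (P j)⁻¹ * a j * (N j : ℝ) = M at hint ⊢
      field_simp
      linear_combination -4 * hint
    have hE : 0 ≤ ∑ x, G.μ x * Q x := Finset.sum_nonneg hμQ
    refine ⟨?_, fun hnot => ?_⟩
    · rw [← sub_nonneg, hlam_eq]
      positivity
    · rw [← sub_pos, hlam_eq]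
      refine div_pos (mul_pos (by positivity) (hE.lt_of_ne' fun h0 => hnot ?_)) (by positivity)
      refine hu.isUniformVortexConfig hlam hP hK hsymm ha fun j x => ?_
      have hx : Q x = 0 := (mul_eq_zero.1
        ((Finset.sum_eq_zero_iff_of_nonneg hμQ).1 h0 x (Finset.mem_univ x))).resolve_left
          (G.μ_pos x).ne'
      exact sub_eq_zero.1 (congrFun (hS.eq_zero_of_sum_eq_zero hx) j)
  · have hdet : IsUnit K.det := by
      rw [← det_transpose, hK, det_mul, det_diagonal]
      exact isUnit_iff_ne_zero.2 (mul_pos (Finset.prod_pos fun i _ => hP i) hS.det_pos).ne'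
    have hv₀ : ∀ j, ∑ k, K k j * Real.exp (Real.log (a k)) = 1 := fun j => by
      have h : ∑ k, K k j * Real.exp (Real.log (a k)) = P j * ∑ k, S k j * a k := by
        rw [Finset.mul_sum]
        refine Finset.sum_congr rfl fun k _ => ?_
        rw [apply_eq_of_transpose_eq hK, hsymm j k, Real.exp_log (hapos k), mul_assoc]
      rw [h, ha j, mul_inv_cancel₀ (hP j).ne']
    obtain ⟨L, hL⟩ := eventually_atTop.1 (eventually_exists_isCSHSolution G N p hdet hv₀)
    -- The maximum serves only to make the bound exceed the threshold strictly.
    exact ⟨max L (cshThreshold G K P N + 1), lt_max_of_lt_right (lt_add_one _),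
      fun lam h => hL lam ((le_max_left _ _).trans h.le)⟩
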